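/- Work in the category of locales, the opposite of the category of frames (complete lattices with $x\wedge\bigvee_i y_i=\bigvee_i (x\wedge y_i)$, and maps preserving finite meets and all joins). For a locale $X$ write $\mathcal{O}X$ for its frame, and for a map of locales $f\colon X\to Y$ write $f^{-1}\colon\mathcal{O}Y\to\mathcal{O}X$ for its frame map. The map $f$ is called open if $f^{-1}$ has a left adjoint $f_!\colon\mathcal{O}X\to\mathcal{O}Y$ such that $f_!(U\wedge f^{-1}(V))=f_!(U)\wedge V$ for all $U\in\mathcal{O}X$, $V\in\mathcal{O}Y$. A localic relation on a locale $X$ is a sublocale $r\colon R\rightarrowtail X\times X$ of the product locale; its source and target maps are $s_R=\mathrm{pr}_1\circ r$ and $t_R=\mathrm{pr}_2\circ r$, from $R$ to $X$. It has open cones if $s_R$ and $t_R$ are both open, and in that case its cones are the maps $\mathcal{O}X\to\mathcal{O}X$ given by $$\uparrow_R\;=\;(t_R)_!\circ s_R^{-1},\qquad \downarrow_R\;=\;(s_R)_!\circ t_R^{-1}.$$ For localic relations $R,Q$ on $X$, let $P=R\times_X Q$ be the pullback of $t_R\colon R\to X$ and $s_Q\colon Q\to X$, with projections $\pi_R\colon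 P\to R$ and $\pi_Q\colon P\to Q$. The composite $R\circ Q$ is the localic relation on $X$ given by the image of $(s_R\circ\pi_R,\;t_Q\circ\pi_Q)\colon P\to X\times X$, where the image of a map of locales $f\colon Y\to Z$ is the sublocale of $Z$ with nucleus $f_*f^{-1}$, and $f_*$ is the right adjoint of $f^{-1}$ (equivalently, the smallest sublocale of $Z$ through which $f$ factors). **Proposition.** Let $X$ be a locale and let $R$ and $Q$ be localic relations on $X$ that have open cones. Then $R\circ Q$ has open cones, and $$\uparrow_{R\circ Q}\;=\;\uparrow_Q\circ\uparrow_R,\qquad \downarrow_{R\circ Q}\;=\;\downarrow_R\circ\downarrow_Q.$$ -/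

import Mathlib

open CategoryTheory CategoryTheory.Limits

universe u

namespace LocalicRel

/-! ### Pushouts of frames

The pushout of frame maps `f : C → A` and `g : C → B` is realised as the frame of those lower sets
of `A × B` which are closed under joins in each coordinate and do not distinguish
`(a ⊓ f c, b)` from `(a, b ⊓ g c)`. -/

section Pushout

variable {A B C : Type u} [Order.Frame A] [Order.Frame B] [Order.Frame C]

theorem mem_himp_iff {D E : LowerSet (A × B)} {x : A × B} :
    x ∈ D ⇨ E ↔ ∀ y ≤ x, y ∈ D → y ∈ E := by
  rw [← LowerSet.Iic_le, le_himp_iff]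
  constructor
  · intro h y hy hD
    exact h ⟨hy, hD⟩
  · rintro h y ⟨hy, hD⟩
    exact h y hy hD

/-- The pushout of `f` and `g`, as a sublocale set of the frame of lower sets of `A × B`. -/
def pushoutSublocale (f : FrameHom C A) (g : FrameHom C B) : Sublocale (LowerSet (A × B)) where
  carrier := {D | (∀ (S : Set A) (b : B), (∀ a ∈ S, (a, b) ∈ D) → (sSup S, b) ∈ D) ∧
    (∀ (a : A) (S : Set B), (∀ b ∈ S, (a, b) ∈ D) → (a, sSup S) ∈ D) ∧
    (∀ (a : A) (b : B) (c : C), (a ⊓ f c, b) ∈ D ↔ (a, b ⊓ g c) ∈ D)}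
  sInf_mem' := by
    intro s hs
    refine ⟨fun S b h => ?_, fun a S h => ?_, fun a b c => ?_⟩
    · simp only [LowerSet.mem_sInf_iff] at h ⊢
      exact fun D hD => (hs hD).1 S b fun a ha => h a ha D hD
    · simp only [LowerSet.mem_sInf_iff] at h ⊢
      exact fun D hD => (hs hD).2.1 a S fun b hb => h b hb D hD
    · simp only [LowerSet.mem_sInf_iff]
      exact forall₂_congr fun D hD => (hs hD).2.2 a b c
  himp_mem' := by
    rintro E D ⟨h1, h2, h3⟩
    refine ⟨fun S b h => ?_, fun a S h => ?_, fun a b c => ?_⟩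
    · rw [mem_himp_iff]
      rintro ⟨a', b'⟩ ⟨ha, hb⟩ hE
      have key : (sSup ((fun s => a' ⊓ s) '' S), b') ∈ D := by
        refine h1 _ _ ?_
        rintro _ ⟨s, hs, rfl⟩
        exact mem_himp_iff.1 (h s hs) _ ⟨inf_le_right, hb⟩ (E.lower (Prod.mk_le_mk.2 ⟨inf_le_left, le_refl b'⟩) hE)
      rw [sSup_image, ← inf_sSup_eq, inf_eq_left.2 ha] at key
      exact key
    · rw [mem_himp_iff]
      rintro ⟨a', b'⟩ ⟨ha, hb⟩ hE
      have key : (a', sSup ((fun s => b' ⊓ s) '' S)) ∈ D := by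
        refine h2 _ _ ?_
        rintro _ ⟨s, hs, rfl⟩
        exact mem_himp_iff.1 (h s hs) _ ⟨ha, inf_le_right⟩ (E.lower (Prod.mk_le_mk.2 ⟨le_refl a', inf_le_left⟩) hE)
      rw [sSup_image, ← inf_sSup_eq, inf_eq_left.2 hb] at key
      exact key
    · rw [mem_himp_iff, mem_himp_iff]
      constructor
      · rintro h ⟨a', b'⟩ ⟨ha, hb⟩ hE
        have hb1 : b' ≤ b := le_trans hb inf_le_left
        have hb2 : b' ≤ g c := le_trans hb inf_le_right
        have := h (a' ⊓ f c, b') ⟨inf_le_inf_right _ ha, hb1⟩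
          (E.lower (Prod.mk_le_mk.2 ⟨inf_le_left, le_refl b'⟩) hE)
        rwa [h3, inf_eq_left.2 hb2] at this
      · rintro h ⟨a', b'⟩ ⟨ha, hb⟩ hE
        have ha1 : a' ≤ a := le_trans ha inf_le_left
        have ha2 : a' ≤ f c := le_trans ha inf_le_right
        have := h (a', b' ⊓ g c) ⟨ha1, inf_le_inf_right _ hb⟩
          (E.lower (Prod.mk_le_mk.2 ⟨le_refl a', inf_le_left⟩) hE)
        rwa [← h3, inf_eq_left.2 ha2] at this

/-- The underlying frame of the pushout of `f` and `g`. -/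
abbrev PushoutFrame (f : FrameHom C A) (g : FrameHom C B) : Type u := ↥(pushoutSublocale f g)

variable (f : FrameHom C A) (g : FrameHom C B)

/-- The basic rectangle `a ⊗ b` in the pushout: the least element containing `(a, b)`. -/
def rect (a : A) (b : B) : PushoutFrame f g :=
  (pushoutSublocale f g).restrict (LowerSet.Iic (a, b))

variable {f g}

theorem rect_le_iff {a : A} {b : B} {D : PushoutFrame f g} :
    rect f g a b ≤ D ↔ (a, b) ∈ D.1 := by
  rw [rect, (pushoutSublocale f g).giRestrict.gc.le_iff_le, LowerSet.Iic_le]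

theorem rect_inf_rect (a a' : A) (b b' : B) :
    rect f g a b ⊓ rect f g a' b' = rect f g (a ⊓ a') (b ⊓ b') := by
  rw [rect, rect, rect, ← map_inf]
  congr 1
  exact (LowerSet.Iic_inf (a, b) (a', b')).symm

theorem rect_top_top : rect f g ⊤ ⊤ = ⊤ := by
  refine top_unique fun x _ => ?_
  exact (rect f g ⊤ ⊤).1.lower ⟨le_top, le_top⟩ (rect_le_iff.1 le_rfl)

theorem rect_mono {a a' : A} {b b' : B} (ha : a ≤ a') (hb : b ≤ b') :
    rect f g a b ≤ rect f g a' b' :=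
  rect_le_iff.2 ((rect f g a' b').1.lower ⟨ha, hb⟩ (rect_le_iff.1 le_rfl))

variable (f g) in
/-- The coprojection `a ↦ a ⊗ ⊤`. -/
def inl : FrameHom A (PushoutFrame f g) where
  toFun a := rect f g a ⊤
  map_inf' a a' := by rw [rect_inf_rect, inf_idem]
  map_top' := rect_top_top
  map_sSup' S := by
    refine le_antisymm (rect_le_iff.2 ?_) (sSup_le ?_)
    · exact (sSup ((fun a => rect f g a ⊤) '' S)).2.1 S ⊤ fun a ha =>
        rect_le_iff.1 (le_sSup ⟨a, ha, rfl⟩)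
    · rintro _ ⟨a, ha, rfl⟩
      exact rect_mono (le_sSup ha) le_rfl

variable (f g) in
/-- The coprojection `b ↦ ⊤ ⊗ b`. -/
def inr : FrameHom B (PushoutFrame f g) where
  toFun b := rect f g ⊤ b
  map_inf' a a' := by rw [rect_inf_rect, inf_idem]
  map_top' := rect_top_top
  map_sSup' S := by
    refine le_antisymm (rect_le_iff.2 ?_) (sSup_le ?_)
    · exact (sSup ((fun b => rect f g ⊤ b) '' S)).2.2.1 ⊤ S fun a ha =>
        rect_le_iff.1 (le_sSup ⟨a, ha, rfl⟩)
    · rintro _ ⟨a, ha, rfl⟩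
      exact rect_mono le_rfl (le_sSup ha)

theorem inl_inf_inr (a : A) (b : B) : inl f g a ⊓ inr f g b = rect f g a b := by
  change rect f g a ⊤ ⊓ rect f g ⊤ b = _
  rw [rect_inf_rect, inf_top_eq, top_inf_eq]

theorem inl_comp_eq : (inl f g).comp f = (inr f g).comp g := by
  ext c : 1
  change rect f g (f c) ⊤ = rect f g ⊤ (g c)
  refine le_antisymm (rect_le_iff.2 ?_) (rect_le_iff.2 ?_)
  · have h : ((⊤ : A), (⊤ : B) ⊓ g c) ∈ (rect f g ⊤ (g c)).1 := by
      rw [top_inf_eq]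
      exact rect_le_iff.1 le_rfl
    have h' := ((rect f g ⊤ (g c)).2.2.2 ⊤ ⊤ c).2 h
    rwa [top_inf_eq] at h'
  · have h : ((⊤ : A) ⊓ f c, (⊤ : B)) ∈ (rect f g (f c) ⊤).1 := by
      rw [top_inf_eq]
      exact rect_le_iff.1 le_rfl
    have h' := ((rect f g (f c) ⊤).2.2.2 ⊤ ⊤ c).1 h
    rwa [top_inf_eq] at h'

theorem eq_iSup_rect (D : PushoutFrame f g) :
    D = sSup {E | ∃ x ∈ D.1, E = inl f g x.1 ⊓ inr f g x.2} := by
  refine le_antisymm ?_ (sSup_le ?_)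
  · intro x hx
    refine rect_le_iff.1 ?_
    rw [← inl_inf_inr]
    exact le_sSup ⟨x, hx, rfl⟩
  · rintro _ ⟨x, hx, rfl⟩
    rw [inl_inf_inr]
    exact rect_le_iff.2 hx

variable {N : Type u} [Order.Frame N]

/-- The right adjoint of the frame map out of the pushout induced by `h` and `k`. -/
def descRight (h : FrameHom A N) (k : FrameHom B N) (w : h.comp f = k.comp g) (n : N) :
    PushoutFrame f g :=
  ⟨⟨{x | h x.1 ⊓ k x.2 ≤ n}, fun _ _ hxy hx => le_trans
      (inf_le_inf (OrderHomClass.mono h hxy.1) (OrderHomClass.mono k hxy.2)) hx⟩, by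
    refine ⟨fun S b hS => ?_, fun a S hS => ?_, fun a b c => ?_⟩
    · change h (sSup S) ⊓ k b ≤ n
      rw [map_sSup, sSup_inf_eq]
      refine iSup₂_le ?_
      rintro _ ⟨a, ha, rfl⟩
      exact hS a ha
    · change h a ⊓ k (sSup S) ≤ n
      rw [map_sSup, inf_sSup_eq]
      refine iSup₂_le ?_
      rintro _ ⟨b, hb, rfl⟩
      exact hS b hb
    · change h (a ⊓ f c) ⊓ k b ≤ n ↔ h a ⊓ k (b ⊓ g c) ≤ n
      have hc : h (f c) = k (g c) := DFunLike.congr_fun w c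
      rw [map_inf, map_inf, hc, inf_assoc, inf_comm (k (g c))]⟩

theorem desc_gc (h : FrameHom A N) (k : FrameHom B N) (w : h.comp f = k.comp g) :
    GaloisConnection (fun D : PushoutFrame f g => ⨆ x ∈ D.1, h x.1 ⊓ k x.2)
      (descRight h k w) := by
  intro D n
  exact iSup₂_le_iff

/-- The frame map out of the pushout induced by `h` and `k`. -/
def desc (h : FrameHom A N) (k : FrameHom B N) (w : h.comp f = k.comp g) :
    FrameHom (PushoutFrame f g) N where
  toFun D := ⨆ x ∈ D.1, h x.1 ⊓ k x.2
  map_inf' D E := by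
    refine le_antisymm ((desc_gc h k w).monotone_l.map_inf_le D E) ?_
    rw [iSup₂_inf_eq]
    refine iSup₂_le fun x hx => ?_
    rw [inf_iSup₂_eq]
    refine iSup₂_le fun y hy => ?_
    refine le_trans (le_of_eq ?_)
      (le_iSup₂ (f := fun (z : A × B) (_ : z ∈ (D ⊓ E).1) => h z.1 ⊓ k z.2) (x ⊓ y)
        ⟨D.1.lower inf_le_left hx, E.1.lower inf_le_right hy⟩)
    change _ = h (x.1 ⊓ y.1) ⊓ k (x.2 ⊓ y.2)
    rw [map_inf, map_inf, inf_inf_inf_comm]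
  map_top' := by
    refine top_unique (le_trans (le_of_eq ?_)
      (le_iSup₂ (f := fun (z : A × B) (_ : z ∈ (⊤ : PushoutFrame f g).1) => h z.1 ⊓ k z.2)
        (⊤, ⊤) trivial))
    rw [map_top, map_top, inf_top_eq]
  map_sSup' S := by
    rw [(desc_gc h k w).l_sSup, sSup_image]

theorem desc_rect (h : FrameHom A N) (k : FrameHom B N) (w : h.comp f = k.comp g)
    (a : A) (b : B) : desc h k w (rect f g a b) = h a ⊓ k b := by
  refine le_antisymm (((desc_gc h k w) _ _).2 (rect_le_iff.2 (le_refl (h a ⊓ k b)))) ?_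
  exact le_iSup₂ (f := fun (z : A × B) (_ : z ∈ (rect f g a b).1) => h z.1 ⊓ k z.2)
    (a, b) (rect_le_iff.1 le_rfl)

theorem desc_comp_inl (h : FrameHom A N) (k : FrameHom B N) (w : h.comp f = k.comp g) :
    (desc h k w).comp (inl f g) = h := by
  ext a : 1
  change desc h k w (rect f g a ⊤) = h a
  rw [desc_rect, map_top, inf_top_eq]

theorem desc_comp_inr (h : FrameHom A N) (k : FrameHom B N) (w : h.comp f = k.comp g) :
    (desc h k w).comp (inr f g) = k := by
  ext b : 1
  change desc h k w (rect f g ⊤ b) = k b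
  rw [desc_rect, map_top, top_inf_eq]

theorem pushout_hom_ext {p q : FrameHom (PushoutFrame f g) N}
    (h1 : p.comp (inl f g) = q.comp (inl f g)) (h2 : p.comp (inr f g) = q.comp (inr f g)) :
    p = q := by
  ext D : 1
  rw [eq_iSup_rect D, map_sSup, map_sSup]
  congr 1
  refine Set.image_congr ?_
  rintro _ ⟨x, -, rfl⟩
  have e1 : p (inl f g x.1) = q (inl f g x.1) := DFunLike.congr_fun h1 x.1
  have e2 : p (inr f g x.2) = q (inr f g x.2) := DFunLike.congr_fun h2 x.2
  rw [map_inf, map_inf, e1, e2]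

end Pushout

theorem isPushout {C A B : Frm.{u}} (f : C ⟶ A) (g : C ⟶ B) :
    IsPushout f g (Frm.ofHom (inl f.hom g.hom)) (Frm.ofHom (inr f.hom g.hom)) where
  w := Frm.hom_ext inl_comp_eq
  isColimit' := ⟨PushoutCocone.IsColimit.mk _
    (fun s => Frm.ofHom (desc s.inl.hom s.inr.hom (congrArg Frm.Hom.hom s.condition)))
    (fun s => Frm.hom_ext (desc_comp_inl _ _ (congrArg Frm.Hom.hom s.condition)))
    (fun s => Frm.hom_ext (desc_comp_inr _ _ (congrArg Frm.Hom.hom s.condition)))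
    (fun s _ h1 h2 => Frm.hom_ext (pushout_hom_ext
      ((congrArg Frm.Hom.hom h1).trans (desc_comp_inl _ _ (congrArg Frm.Hom.hom s.condition)).symm)
      ((congrArg Frm.Hom.hom h2).trans (desc_comp_inr _ _ (congrArg Frm.Hom.hom s.condition)).symm)))⟩

instance : HasPushouts Frm.{u} :=
  have (C A B : Frm.{u}) (f : C ⟶ A) (g : C ⟶ B) : HasColimit (span f g) :=
    (isPushout f g).hasPushout
  hasPushouts_of_hasColimit_span _

/-- The frame map out of the frame of truth values (subsets of a point). -/
def ofTruth (N : Type u) [Order.Frame N] : FrameHom (Set PUnit.{u + 1}) N where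
  toFun S := ⨆ _ : PUnit.unit ∈ S, ⊤
  map_inf' S T := by
    by_cases h1 : PUnit.unit ∈ S <;> by_cases h2 : PUnit.unit ∈ T <;> simp [h1, h2]
  map_top' := by simp
  map_sSup' S := by
    refine le_antisymm (iSup_le ?_) (sSup_le ?_)
    · rintro ⟨T, hT, h⟩
      exact le_trans (by simp [h]) (le_sSup ⟨T, hT, rfl⟩)
    · rintro _ ⟨T, hT, rfl⟩
      exact iSup_le fun h => le_iSup (fun _ : PUnit.unit ∈ sSup S => (⊤ : N)) ⟨T, hT, h⟩

theorem ofTruth_unique {N : Type u} [Order.Frame N] (h : FrameHom (Set PUnit.{u + 1}) N) :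
    h = ofTruth N := by
  ext S : 1
  by_cases hS : PUnit.unit ∈ S
  · have : S = ⊤ := Set.eq_univ_of_forall fun _ => hS
    rw [this, map_top, map_top]
  · have : S = ⊥ := Set.eq_empty_of_forall_notMem fun _ => hS
    rw [this, map_bot, map_bot]

instance : HasInitial Frm.{u} :=
  (IsInitial.ofUniqueHom (X := Frm.of (Set PUnit.{u + 1})) (fun N => Frm.ofHom (ofTruth N))
    fun _ m => Frm.hom_ext (ofTruth_unique m.hom)).hasInitial

instance : HasPullbacks Locale.{u} := inferInstanceAs (HasPullbacks Frm.{u}ᵒᵖ)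

instance : HasTerminal Locale.{u} := inferInstanceAs (HasTerminal Frm.{u}ᵒᵖ)

instance : HasBinaryProducts Locale.{u} := hasBinaryProducts_of_hasTerminal_and_pullbacks _

/-! ### Maps of locales -/

/-- The frame map `f⁻¹ : 𝒪 Y → 𝒪 X` underlying a map of locales `f : X ⟶ Y`. -/
def preimage {X Y : Locale.{u}} (f : X ⟶ Y) : FrameHom Y X :=
  Frm.Hom.hom (Quiver.Hom.unop f)

/-- A map of locales is open if its frame map has a left adjoint satisfying Frobenius
reciprocity. -/
def IsOpenMap {X Y : Locale.{u}} (f : X ⟶ Y) : Prop :=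
  ∃ l : X → Y, GaloisConnection l (preimage f) ∧
    ∀ (U : X) (V : Y), l (U ⊓ preimage f V) = l U ⊓ V

/-- The map `f_!`, given by the formula for the left adjoint of `f⁻¹`. -/
def lowerAdjoint {X Y : Locale.{u}} (f : X ⟶ Y) (U : X) : Y :=
  sInf {V | U ≤ preimage f V}

/-- For an open map, `f_!` is indeed the left adjoint of `f⁻¹`. -/
theorem IsOpenMap.gc {X Y : Locale.{u}} {f : X ⟶ Y} (hf : IsOpenMap f) :
    GaloisConnection (lowerAdjoint f) (preimage f) := by
  obtain ⟨l, hl, -⟩ := hf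
  have : lowerAdjoint f = l := by
    funext U
    exact le_antisymm (sInf_le (hl.le_u_l U)) (le_sInf fun V hV => hl.l_le hV)
  rwa [this]

/-- The right adjoint `f_*` of `f⁻¹`. -/
def directImage {X Y : Locale.{u}} (f : X ⟶ Y) (U : X) : Y :=
  sSup {V | preimage f V ≤ U}

theorem gc_directImage {X Y : Locale.{u}} (f : X ⟶ Y) :
    GaloisConnection (preimage f) (directImage f) := by
  intro V U
  refine ⟨fun h => le_sSup h, fun h => le_trans (OrderHomClass.mono (preimage f) h) ?_⟩
  rw [directImage, map_sSup]
  exact sSup_le (by rintro _ ⟨W, hW, rfl⟩; exact hW)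

/-- The image of a map of locales `f : X ⟶ Y`: the sublocale of `Y` whose nucleus is
`f_* f⁻¹`. -/
def image {X Y : Locale.{u}} (f : X ⟶ Y) : Sublocale Y :=
  Nucleus.toSublocale
    { toFun := fun V => directImage f (preimage f V)
      map_inf' := fun V W => by rw [map_inf, (gc_directImage f).u_inf]
      idempotent' := fun V => le_of_eq ((gc_directImage f).u_l_u_eq_u _)
      le_apply' := fun V => (gc_directImage f).le_u_l V }

/-- A sublocale, as a locale in its own right. -/
abbrev subLoc {X : Locale.{u}} (S : Sublocale X) : Locale.{u} := Locale.of S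

/-- The inclusion of a sublocale; its frame map is the quotient map `S.restrict`. -/
def inclusion {X : Locale.{u}} (S : Sublocale X) : subLoc S ⟶ X :=
  Quiver.Hom.op (Frm.ofHom S.restrict)

/-! ### Localic relations -/

/-- A localic relation on `X` is a sublocale of `X × X`. -/
abbrev Relation (X : Locale.{u}) : Type u := Sublocale ↥(X ⨯ X)

namespace Relation

variable {X : Locale.{u}}

/-- The source map `R ⟶ X`. -/
noncomputable def source (R : Relation X) : subLoc R ⟶ X := inclusion R ≫ prod.fst

/-- The target map `R ⟶ X`. -/
noncomputable def target (R : Relation X) : subLoc R ⟶ X := inclusion R ≫ prod.snd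

/-- A relation has open cones if its source and target maps are open. -/
def HasOpenCones (R : Relation X) : Prop := IsOpenMap R.source ∧ IsOpenMap R.target

/-- The up cone `t_! s⁻¹`. -/
noncomputable def up (R : Relation X) : X → X :=
  fun U => lowerAdjoint R.target (preimage R.source U)

/-- The down cone `s_! t⁻¹`. -/
noncomputable def down (R : Relation X) : X → X :=
  fun U => lowerAdjoint R.source (preimage R.target U)

/-- The composite `R ∘ Q` (first `R`, then `Q`): the image in `X × X` of the map
`(s_R π_R, t_Q π_Q)` from the pullback of `t_R` and `s_Q`. -/
noncomputable def comp (R Q : Relation X) : Relation X :=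
  image (prod.lift (pullback.fst R.target Q.source ≫ R.source)
    (pullback.snd R.target Q.source ≫ Q.target))

end Relation

end LocalicRel

/-!
Everything rests on two facts about an open map.

* *Stability under pullback, with the Beck–Chevalley condition.* The pushout of the frame maps
  `f : C → A` and `g : C → B` is the tensor product `A ⊗ B` of complete lattices with an action
  of `C`. Frobenius reciprocity says that the left adjoint `l` of an open `g` is `C`-linear, so
  `a ⊗ b ↦ a ⊓ f (l b)` is a well-defined map `A ⊗ B → A`, and it is left adjoint to
  `a ↦ a ⊗ ⊤`.
* *Descent along a surjection.* If `e ≫ p` is open and `e⁻¹` is injective, then `p` is open and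
  `p_! = (e ≫ p)_! e⁻¹`.

The pullback `P` of `t_R` and `s_Q` surjects onto its image `R ∘ Q`, so the legs and the cones of
`R ∘ Q` can be computed on the span `X ← P → X`, whose legs are composites of open maps.
-/

namespace LocalicRel

section TensorProduct

variable {A B C : Type u} [Order.Frame A] [Order.Frame B] [Order.Frame C]
  {f : FrameHom C A} {g : FrameHom C B}

theorem mem_coe_rect (a : A) (b : B) : (a, b) ∈ (rect f g a b).1 :=
  rect_le_iff.1 le_rfl

theorem rect_inf_apply (a : A) (b : B) (c : C) :
    rect f g (a ⊓ f c) b = rect f g a (b ⊓ g c) :=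
  le_antisymm (rect_le_iff.2 (((rect f g a (b ⊓ g c)).2.2.2 a b c).2 (mem_coe_rect _ _)))
    (rect_le_iff.2 (((rect f g (a ⊓ f c) b).2.2.2 a b c).1 (mem_coe_rect _ _)))

/-- Maps `A × B → N` that preserve joins in each variable and are balanced over `C`, where `C`
acts on `A` and `B` by meets with `f c` and `g c`. They correspond to the join-preserving maps
from the pushout of `f` and `g` to `N`. -/
structure IsBalancedBimorphism {N : Type*} [CompleteLattice N] (f : FrameHom C A)
    (g : FrameHom C B) (φ : A → B → N) : Prop where
  map_sSup_left (S : Set A) (b : B) : φ (sSup S) b = ⨆ a ∈ S, φ a b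
  map_sSup_right (a : A) (S : Set B) : φ a (sSup S) = ⨆ b ∈ S, φ a b
  balanced (a : A) (b : B) (c : C) : φ (a ⊓ f c) b = φ a (b ⊓ g c)

variable {N : Type*} [CompleteLattice N] {φ : A → B → N}

theorem IsBalancedBimorphism.mono (hφ : IsBalancedBimorphism f g φ) {a a' : A} {b b' : B}
    (ha : a ≤ a') (hb : b ≤ b') : φ a b ≤ φ a' b' :=
  calc
    φ a b ≤ ⨆ x ∈ ({a, a'} : Set A), φ x b := le_iSup₂ (f := fun x _ => φ x b) a (.inl rfl)
    _ = φ a' b := by rw [← hφ.map_sSup_left, sSup_pair, sup_eq_right.2 ha]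
    _ ≤ ⨆ y ∈ ({b, b'} : Set B), φ a' y := le_iSup₂ (f := fun y _ => φ a' y) b (.inl rfl)
    _ = φ a' b' := by rw [← hφ.map_sSup_right, sSup_pair, sup_eq_right.2 hb]

/-- The element of the pushout consisting of the pairs that `φ` sends below `n`; as a function of
`n` it is the right adjoint of `tensorLift f g φ`. -/
def IsBalancedBimorphism.sublevel (hφ : IsBalancedBimorphism f g φ) (n : N) :
    PushoutFrame f g where
  val := ⟨{x | φ x.1 x.2 ≤ n}, fun _ _ hyx hx => (hφ.mono hyx.1 hyx.2).trans hx⟩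
  property :=
    ⟨fun S b hS => (hφ.map_sSup_left S b).trans_le (iSup₂_le hS),
      fun a S hS => (hφ.map_sSup_right a S).trans_le (iSup₂_le hS),
      fun a b c => iff_of_eq (congrArg (· ≤ n) (hφ.balanced a b c))⟩

variable (f g φ) in
/-- The map from the pushout of `f` and `g` induced by `φ`. It is join-preserving, and sends
`a ⊗ b` to `φ a b`, when `φ` is a balanced bimorphism. -/
def tensorLift (D : PushoutFrame f g) : N :=
  ⨆ x ∈ D.1, φ x.1 x.2

theorem le_tensorLift {D : PushoutFrame f g} {a : A} {b : B} (h : rect f g a b ≤ D) :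
    φ a b ≤ tensorLift f g φ D :=
  le_iSup₂ (f := fun (x : A × B) (_ : x ∈ D.1) => φ x.1 x.2) (a, b) (rect_le_iff.1 h)

theorem IsBalancedBimorphism.gc_tensorLift (hφ : IsBalancedBimorphism f g φ) :
    GaloisConnection (tensorLift f g φ) hφ.sublevel :=
  fun _ _ => iSup₂_le_iff

theorem IsBalancedBimorphism.tensorLift_rect (hφ : IsBalancedBimorphism f g φ) (a : A) (b : B) :
    tensorLift f g φ (rect f g a b) = φ a b :=
  le_antisymm (hφ.gc_tensorLift.l_le (rect_le_iff.2 (le_refl (φ a b)))) (le_tensorLift le_rfl)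

end TensorProduct

section OpenPushout

variable {A B C : Type u} [Order.Frame A] [Order.Frame B] [Order.Frame C]
  {f : FrameHom C A} {g : FrameHom C B} {l : B → C}

theorem isBalancedBimorphism_inf_apply (hl : GaloisConnection l g)
    (frobenius : ∀ b c, l (b ⊓ g c) = l b ⊓ c) :
    IsBalancedBimorphism f g fun a b => a ⊓ f (l b) where
  map_sSup_left _ _ := sSup_inf_eq
  map_sSup_right a S := by rw [hl.l_sSup, map_iSup₂, inf_iSup₂_eq]
  balanced a b c := by rw [frobenius, map_inf, inf_assoc, inf_comm (f c)]

theorem gc_tensorLift_inl (hl : GaloisConnection l g)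
    (frobenius : ∀ b c, l (b ⊓ g c) = l b ⊓ c) :
    GaloisConnection (tensorLift f g fun a b => a ⊓ f (l b)) (inl f g) := by
  have hφ := isBalancedBimorphism_inf_apply (f := f) hl frobenius
  have inl_mono : Monotone (inl f g) := OrderHomClass.mono _
  refine .monotone_intro inl_mono hφ.gc_tensorLift.monotone_l ?unit ?counit
  case unit =>
    rintro D ⟨a, b⟩ hab
    refine rect_le_iff.1 ?_
    calc
      rect f g a b ≤ rect f g a (⊤ ⊓ g (l b)) :=
        rect_mono le_rfl (le_inf le_top (hl.le_u_l b))
      _ = inl f g (a ⊓ f (l b)) := (rect_inf_apply a ⊤ (l b)).symm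
      _ ≤ inl f g (tensorLift f g (fun a b => a ⊓ f (l b)) D) :=
        inl_mono (le_tensorLift (φ := fun a b => a ⊓ f (l b)) (rect_le_iff.2 hab))
  case counit => exact fun a => (hφ.tensorLift_rect a ⊤).trans_le inf_le_left

theorem tensorLift_inf_inl (hl : GaloisConnection l g)
    (frobenius : ∀ b c, l (b ⊓ g c) = l b ⊓ c) (D : PushoutFrame f g) (a : A) :
    tensorLift f g (fun a b => a ⊓ f (l b)) (D ⊓ inl f g a) =
      tensorLift f g (fun a b => a ⊓ f (l b)) D ⊓ a := by
  have gc := gc_tensorLift_inl (f := f) hl frobenius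
  refine le_antisymm (le_inf (gc.monotone_l inf_le_left) (gc.l_le inf_le_right)) ?_
  rw [tensorLift, iSup₂_inf_eq]
  refine iSup₂_le fun x hx => ?_
  rw [inf_right_comm]
  have left_le : rect f g (x.1 ⊓ a) x.2 ≤ D :=
    (rect_mono inf_le_left le_rfl).trans (rect_le_iff.2 hx)
  have right_le : rect f g (x.1 ⊓ a) x.2 ≤ inl f g a := rect_mono inf_le_right le_top
  exact le_tensorLift (φ := fun a b => a ⊓ f (l b)) (le_inf left_le right_le)

theorem tensorLift_inr (hl : GaloisConnection l g)
    (frobenius : ∀ b c, l (b ⊓ g c) = l b ⊓ c) (b : B) :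
    tensorLift f g (fun a b => a ⊓ f (l b)) (inr f g b) = f (l b) :=
  ((isBalancedBimorphism_inf_apply hl frobenius).tensorLift_rect ⊤ b).trans (top_inf_eq _)

end OpenPushout

section OpenMaps

variable {X Y Z : Locale.{u}}

theorem preimage_comp (f : X ⟶ Y) (g : Y ⟶ Z) (W : Z) :
    preimage (f ≫ g) W = preimage f (preimage g W) := rfl

theorem lowerAdjoint_eq_of_gc {f : X ⟶ Y} {l : X → Y} (hl : GaloisConnection l (preimage f)) :
    lowerAdjoint f = l :=
  funext fun U => le_antisymm (sInf_le (hl.le_u_l U)) (le_sInf fun _ hV => hl.l_le hV)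

theorem IsOpenMap.frobenius {f : X ⟶ Y} (hf : IsOpenMap f) (U : X) (V : Y) :
    lowerAdjoint f (U ⊓ preimage f V) = lowerAdjoint f U ⊓ V := by
  obtain ⟨l, hl, h⟩ := hf
  rw [lowerAdjoint_eq_of_gc hl, h]

theorem isOpenMap_id (X : Locale.{u}) : IsOpenMap (𝟙 X) :=
  ⟨id, GaloisConnection.id, fun _ _ => rfl⟩

theorem IsOpenMap.comp {f : X ⟶ Y} {g : Y ⟶ Z} (hf : IsOpenMap f) (hg : IsOpenMap g) :
    IsOpenMap (f ≫ g) :=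
  ⟨_, hf.gc.compose hg.gc, fun U V => by
    rw [Function.comp_apply, Function.comp_apply, preimage_comp, hf.frobenius, hg.frobenius]⟩

theorem IsOpenMap.lowerAdjoint_comp {f : X ⟶ Y} {g : Y ⟶ Z} (hf : IsOpenMap f)
    (hg : IsOpenMap g) (U : X) :
    lowerAdjoint (f ≫ g) U = lowerAdjoint g (lowerAdjoint f U) :=
  congrFun (lowerAdjoint_eq_of_gc (f := f ≫ g) (hf.gc.compose hg.gc)) U

theorem preimage_le_preimage_iff {e : X ⟶ Y} (he : Function.Injective (preimage e)) {U V : Y} :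
    preimage e U ≤ preimage e V ↔ U ≤ V :=
  (orderEmbeddingOfInjective (preimage e) he).le_iff_le

theorem IsOpenMap.of_comp {e : X ⟶ Y} {p : Y ⟶ Z} (he : Function.Injective (preimage e))
    (h : IsOpenMap (e ≫ p)) : IsOpenMap p := by
  obtain ⟨l, hl, frobenius⟩ := h
  refine ⟨fun U => l (preimage e U), fun U V => ?_, fun U V => ?_⟩
  · exact (hl _ V).trans (preimage_le_preimage_iff he)
  · exact (congrArg l (map_inf (preimage e) U _)).trans (frobenius _ V)

theorem lowerAdjoint_comp_preimage {e : X ⟶ Y} (he : Function.Injective (preimage e))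
    (p : Y ⟶ Z) (U : Y) : lowerAdjoint (e ≫ p) (preimage e U) = lowerAdjoint p U := by
  simp only [lowerAdjoint, preimage_comp, preimage_le_preimage_iff he]

theorem preimage_hom_preimage_inv (e : X ≅ Y) (U : X) :
    preimage e.hom (preimage e.inv U) = U := by
  rw [← preimage_comp, e.hom_inv_id]
  rfl

theorem preimage_iso_hom_injective (e : X ≅ Y) : Function.Injective (preimage e.hom) :=
  Function.LeftInverse.injective (preimage_hom_preimage_inv e.symm)

theorem isOpenMap_iso_hom (e : X ≅ Y) : IsOpenMap e.hom :=
  .of_comp (e := e.inv) (preimage_iso_hom_injective e.symm) (by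
    rw [e.inv_hom_id]
    exact isOpenMap_id Y)

end OpenMaps

section Pullback

variable {P X Y Z : Locale.{u}} {p : P ⟶ X} {q : P ⟶ Y} {f : X ⟶ Z} {g : Y ⟶ Z}

/-- The first projection from the standard pullback of locales, the one dual to the pushout
`PushoutFrame` of frames. -/
def pullbackFst (f : X ⟶ Z) (g : Y ⟶ Z) :
    Locale.of (PushoutFrame (preimage f) (preimage g)) ⟶ X :=
  Quiver.Hom.op (Frm.ofHom (inl (preimage f) (preimage g)))

/-- The second projection from the standard pullback of locales. -/
def pullbackSnd (f : X ⟶ Z) (g : Y ⟶ Z) :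
    Locale.of (PushoutFrame (preimage f) (preimage g)) ⟶ Y :=
  Quiver.Hom.op (Frm.ofHom (inr (preimage f) (preimage g)))

theorem isPullback_pullbackFst_pullbackSnd (f : X ⟶ Z) (g : Y ⟶ Z) :
    IsPullback (pullbackFst f g) (pullbackSnd f g) f g :=
  (isPushout (Quiver.Hom.unop f) (Quiver.Hom.unop g)).op.flip

theorem isOpenMap_pullbackFst (f : X ⟶ Z) (hg : IsOpenMap g) : IsOpenMap (pullbackFst f g) :=
  ⟨_, gc_tensorLift_inl hg.gc hg.frobenius, tensorLift_inf_inl hg.gc hg.frobenius⟩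

theorem lowerAdjoint_pullbackFst (f : X ⟶ Z) (hg : IsOpenMap g) (V : Y) :
    lowerAdjoint (pullbackFst f g) (preimage (pullbackSnd f g) V) =
      preimage f (lowerAdjoint g V) :=
  (congrFun (lowerAdjoint_eq_of_gc (gc_tensorLift_inl hg.gc hg.frobenius)) _).trans
    (tensorLift_inr hg.gc hg.frobenius V)

theorem IsOpenMap.of_isPullback (sq : IsPullback p q f g) (hg : IsOpenMap g) : IsOpenMap p := by
  rw [← sq.isoIsPullback_hom_fst _ _ (isPullback_pullbackFst_pullbackSnd f g)]
  exact (isOpenMap_iso_hom _).comp (isOpenMap_pullbackFst f hg)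

theorem lowerAdjoint_preimage_of_isPullback (sq : IsPullback p q f g) (hg : IsOpenMap g) (V : Y) :
    lowerAdjoint p (preimage q V) = preimage f (lowerAdjoint g V) := by
  have sq' := isPullback_pullbackFst_pullbackSnd f g
  obtain ⟨e, rfl, rfl⟩ : ∃ e : P ≅ Locale.of (PushoutFrame (preimage f) (preimage g)),
      e.hom ≫ pullbackFst f g = p ∧ e.hom ≫ pullbackSnd f g = q :=
    ⟨sq.isoIsPullback _ _ sq', sq.isoIsPullback_hom_fst _ _ sq', sq.isoIsPullback_hom_snd _ _ sq'⟩
  rw [preimage_comp, lowerAdjoint_comp_preimage (preimage_iso_hom_injective e),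
    lowerAdjoint_pullbackFst f hg]

end Pullback

section Image

variable {X Y : Locale.{u}}

theorem directImage_preimage_coe (f : X ⟶ Y) (U : image f) :
    directImage f (preimage f U.1) = U.1 := by
  obtain ⟨V, hV⟩ := U.2
  rw [← hV]
  exact (gc_directImage f).u_l_u_eq_u _

theorem preimage_restrict_image (f : X ⟶ Y) (V : Y) :
    preimage f ((image f).restrict V).1 = preimage f V := by
  rw [image, Nucleus.restrict_toSublocale]
  exact (gc_directImage f).l_u_l_eq_l V

/-- The corestriction of a map of locales to its image. -/
def toImage (f : X ⟶ Y) : X ⟶ subLoc (image f) :=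
  Quiver.Hom.op <| Frm.ofHom
    { toFun := fun U => preimage f U.1
      map_inf' := fun U V => map_inf (preimage f) U.1 V.1
      map_top' := map_top (preimage f)
      map_sSup' := fun S => by
        rw [← (image f).giRestrict.l_sSup_u_image, preimage_restrict_image, map_sSup,
          Set.image_image] }

theorem toImage_inclusion (f : X ⟶ Y) : toImage f ≫ inclusion (image f) = f :=
  Quiver.Hom.unop_inj (Frm.hom_ext (FrameHom.ext (preimage_restrict_image f)))

theorem preimage_toImage_injective (f : X ⟶ Y) : Function.Injective (preimage (toImage f)) := by
  intro U V (h : preimage f U.1 = preimage f V.1)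
  refine Subtype.ext ?_
  rw [← directImage_preimage_coe f U, h]
  exact directImage_preimage_coe f V

end Image

namespace Relation

variable {X : Locale.{u}}

/-- The surjection onto `R ∘ Q` from the pullback of `t_R` and `s_Q`. -/
noncomputable def toComp (R Q : Relation X) :
    pullback R.target Q.source ⟶ subLoc (R.comp Q) :=
  toImage _

variable {R Q : Relation X}

theorem preimage_toComp_injective : Function.Injective (preimage (toComp R Q)) :=
  preimage_toImage_injective _

theorem toComp_inclusion :
    toComp R Q ≫ inclusion (R.comp Q) =
      prod.lift (pullback.fst R.target Q.source ≫ R.source)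
        (pullback.snd R.target Q.source ≫ Q.target) :=
  toImage_inclusion _

theorem toComp_source :
    toComp R Q ≫ (R.comp Q).source = pullback.fst R.target Q.source ≫ R.source := by
  change toComp R Q ≫ inclusion (R.comp Q) ≫ prod.fst = _
  rw [← Category.assoc, toComp_inclusion, prod.lift_fst]

theorem toComp_target :
    toComp R Q ≫ (R.comp Q).target = pullback.snd R.target Q.source ≫ Q.target := by
  change toComp R Q ≫ inclusion (R.comp Q) ≫ prod.snd = _
  rw [← Category.assoc, toComp_inclusion, prod.lift_snd]

theorem isOpenMap_source_comp (hR : IsOpenMap R.source) (hQ : IsOpenMap Q.source) :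
    IsOpenMap (R.comp Q).source := by
  refine .of_comp preimage_toComp_injective ?_
  rw [toComp_source]
  exact (IsOpenMap.of_isPullback (.of_hasPullback _ _) hQ).comp hR

theorem isOpenMap_target_comp (hR : IsOpenMap R.target) (hQ : IsOpenMap Q.target) :
    IsOpenMap (R.comp Q).target := by
  refine .of_comp preimage_toComp_injective ?_
  rw [toComp_target]
  exact (IsOpenMap.of_isPullback (IsPullback.of_hasPullback _ _).flip hR).comp hQ

theorem up_comp (hR : IsOpenMap R.target) (hQ : IsOpenMap Q.target) :
    (R.comp Q).up = Q.up ∘ R.up := by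
  funext U
  have sq := (IsPullback.of_hasPullback R.target Q.source).flip
  calc
    (R.comp Q).up U
    _ = lowerAdjoint (toComp R Q ≫ (R.comp Q).target)
          (preimage (toComp R Q ≫ (R.comp Q).source) U) :=
        (lowerAdjoint_comp_preimage preimage_toComp_injective _ _).symm
    _ = lowerAdjoint (pullback.snd R.target Q.source ≫ Q.target)
          (preimage (pullback.fst R.target Q.source) (preimage R.source U)) := by
        rw [toComp_source, toComp_target, preimage_comp]
    _ = Q.up (R.up U) := by
        rw [(IsOpenMap.of_isPullback sq hR).lowerAdjoint_comp hQ,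
          lowerAdjoint_preimage_of_isPullback sq hR, up, up]

theorem down_comp (hR : IsOpenMap R.source) (hQ : IsOpenMap Q.source) :
    (R.comp Q).down = R.down ∘ Q.down := by
  funext U
  have sq := IsPullback.of_hasPullback R.target Q.source
  calc
    (R.comp Q).down U
    _ = lowerAdjoint (toComp R Q ≫ (R.comp Q).source)
          (preimage (toComp R Q ≫ (R.comp Q).target) U) :=
        (lowerAdjoint_comp_preimage preimage_toComp_injective _ _).symm
    _ = lowerAdjoint (pullback.fst R.target Q.source ≫ R.source)
          (preimage (pullback.snd R.target Q.source) (preimage Q.target U)) := by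
        rw [toComp_source, toComp_target, preimage_comp]
    _ = R.down (Q.down U) := by
        rw [(IsOpenMap.of_isPullback sq hQ).lowerAdjoint_comp hR,
          lowerAdjoint_preimage_of_isPullback sq hQ, down, down]

end Relation

end LocalicRel

theorem mainTheorem9 (X : Locale.{u}) (R Q : LocalicRel.Relation X)
    (hR : R.HasOpenCones) (hQ : Q.HasOpenCones) :
    (R.comp Q).HasOpenCones ∧
      (R.comp Q).up = Q.up ∘ R.up ∧
      (R.comp Q).down = R.down ∘ Q.down :=
  ⟨⟨LocalicRel.Relation.isOpenMap_source_comp hR.1 hQ.1,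
      LocalicRel.Relation.isOpenMap_target_comp hR.2 hQ.2⟩,
    LocalicRel.Relation.up_comp hR.2 hQ.2, LocalicRel.Relation.down_comp hR.1 hQ.1⟩
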